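/- A germ in $\mathrm{diff}(\mathbb{R}^n,0)$ means the germ at $0$ of an analytic diffeomorphism of neighbourhoods of $0$ in $\mathbb{R}^n$ fixing $0$. For an analytic vector field $v$ near $0$ with $v(0)=0$, $\exp v$ denotes the germ of its flow at time $t=1$. Let $u\in\mathrm{diff}(\mathbb{R}^n,0)$ be an analytic germ with Jacobian matrix $J(0)$ at $0$, and let $\lambda_1,\dots,\lambda_n\in\mathbb{C}$ be the eigenvalues of $J(0)$, listed with algebraic multiplicity. Suppose that $|\lambda_i|<1$ for all $i$, and that the eigenvalues are non-resonant: there are no index $s$ and integers $m_1,\dots,m_n\ge 0$ with $\sum_i m_i\ge 2$ and $\lambda_s=\lambda_1^{m_1}\cdots\lambda_n^{m_n}$. Then: 1. There is a germ $f\in\mathrm{diff}(\mathbb{R}^n,0)$ that linearizes $u$, that is, $f\circ u\circ f^{-1}(x)=J(0)x$. 2. Let $L$ be a real matrix with $e^{L}=J(0)$ and let $f\in\mathrm{diff}(\mathbb{R}^n,0)$ be any germ that linearizes $u$. Then $\varphi^t=f^{-1}(e^{tL}f)$, $t\in\mathbb{R}$, is a family of germs in $\mathrm{diff}(\mathbb{R}^n,0)$,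 analytic jointly in $(t,x)$ near every point $(t,0)$, which solves the embedding problem $$\varphi^t\circ\varphi^s=\varphi^{t+s},\qquad \varphi^t(0)=0,\qquad \varphi^0(x)=x,\qquad \varphi^1=u .$$ Moreover $\varphi^t$ is the germ of the flow of an analytic vector field $v$ with $v(0)=0$, and so $u=\exp v$. 3. Suppose in addition that $|J(0)-E|<1$ for some submultiplicative norm $|\cdot|$ on the real $n\times n$ matrices, where $E$ is the identity matrix. Then the series $\ln J(0)=\sum_{k\ge1}\frac{(-1)^{k+1}}{k}(J(0)-E)^k$ converges and $e^{\ln J(0)}=J(0)$. Hence, for every germ $f$ that linearizes $u$, $\varphi^t=f^{-1}(J^t(0)f)$ with $J^t(0)=e^{t\ln J(0)}$ solves the embedding problem, and $u$ lies in the image of $\exp$. -/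

import Mathlib

open Filter Topology

/-- `g` represents the inverse of the germ at `0` of an analytic map `f` of `ℝⁿ` fixing `0`. -/
structure IsGermInverse {n : ℕ} (f g : (Fin n → ℝ) → (Fin n → ℝ)) : Prop where
  map_zero : g 0 = 0
  analyticAt : AnalyticAt ℝ g 0
  left_inv : g ∘ f =ᶠ[𝓝 0] id
  right_inv : f ∘ g =ᶠ[𝓝 0] id

/-- `u` represents a germ of an analytic diffeomorphism of `ℝⁿ` at `0` that fixes `0`. Equality of
germs is equality on a neighbourhood of `0`. -/
structure IsDiffGerm {n : ℕ} (u : (Fin n → ℝ) → (Fin n → ℝ)) : Prop where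
  map_zero : u 0 = 0
  analyticAt : AnalyticAt ℝ u 0
  exists_inverse : ∃ g, IsGermInverse u g

/-- The Jacobian matrix `J(0)` of `u` at the origin. -/
noncomputable def jacobianAtZero {n : ℕ} (u : (Fin n → ℝ) → (Fin n → ℝ)) :
    Matrix (Fin n) (Fin n) ℝ :=
  LinearMap.toMatrix' (fderiv ℝ u 0 : (Fin n → ℝ) →ₗ[ℝ] (Fin n → ℝ))

/-- `lam` lists the complex eigenvalues of the real matrix `A`, with algebraic multiplicity. -/
def IsEigenvalueList {n : ℕ} (A : Matrix (Fin n) (Fin n) ℝ) (lam : Fin n → ℂ) : Prop :=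
  (A.map (algebraMap ℝ ℂ)).charpoly = ∏ i, (Polynomial.X - Polynomial.C (lam i))

/-- Resonance: `λ_s = λ_1 ^ m_1 ⋯ λ_n ^ m_n` for some `s` and `m_i ≥ 0` with `∑ m_i ≥ 2`. -/
def IsResonant {n : ℕ} (lam : Fin n → ℂ) : Prop :=
  ∃ (s : Fin n) (m : Fin n → ℕ), 2 ≤ ∑ i, m i ∧ lam s = ∏ i, lam i ^ m i

/-- The germ `f`, with inverse germ `g`, conjugates `u` to its linear part:
`f ∘ u ∘ f⁻¹ = J(0)` as germs. -/
structure IsLinearization {n : ℕ} (u f g : (Fin n → ℝ) → (Fin n → ℝ)) : Prop where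
  isDiffGerm : IsDiffGerm f
  isGermInverse : IsGermInverse f g
  conj : f ∘ u ∘ g =ᶠ[𝓝 0] fun x => (jacobianAtZero u).mulVec x

/-- `φ` solves the embedding problem for `u`: it is an analytic one-parameter group of germs of
analytic diffeomorphisms fixing `0`, equal to the germ `u` at time `1`. -/
structure IsEmbeddingFlow {n : ℕ} (u : (Fin n → ℝ) → (Fin n → ℝ))
    (φ : ℝ → (Fin n → ℝ) → (Fin n → ℝ)) : Prop where
  isDiffGerm : ∀ t, IsDiffGerm (φ t)
  analyticAt : ∀ t : ℝ, AnalyticAt ℝ (fun p : ℝ × (Fin n → ℝ) => φ p.1 p.2) (t, 0)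
  comp : ∀ t s, φ t ∘ φ s =ᶠ[𝓝 0] φ (t + s)
  map_zero : ∀ t, φ t 0 = 0
  time_zero : φ 0 =ᶠ[𝓝 0] id
  time_one : φ 1 =ᶠ[𝓝 0] u

/-- The family of maps `φ^t = f⁻¹ (e^{t L} f)`, with `g` in the role of `f⁻¹`. -/
noncomputable def conjFlow {n : ℕ} (f g : (Fin n → ℝ) → (Fin n → ℝ))
    (L : Matrix (Fin n) (Fin n) ℝ) (t : ℝ) (x : Fin n → ℝ) : Fin n → ℝ :=
  g ((NormedSpace.exp (t • L)).mulVec (f x))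

/-- The `k`-th term of `ln A = ∑ (-1)^k (A - E)^(k+1) / (k+1)`. -/
noncomputable def matrixLogTerm {n : ℕ} (A : Matrix (Fin n) (Fin n) ℝ) (k : ℕ) :
    Matrix (Fin n) (Fin n) ℝ :=
  ((-1 : ℝ) ^ k / ((k : ℝ) + 1)) • (A - 1) ^ (k + 1)

/-- The logarithm `ln A` as the sum of the logarithmic series. -/
noncomputable def matrixLog {n : ℕ} (A : Matrix (Fin n) (Fin n) ℝ) :
    Matrix (Fin n) (Fin n) ℝ :=
  ∑' k, matrixLogTerm A k

/-- `v` represents a germ at `0` of an analytic vector field vanishing at `0`. -/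
structure IsVectorFieldGerm {n : ℕ} (v : (Fin n → ℝ) → (Fin n → ℝ)) : Prop where
  map_zero : v 0 = 0
  analyticAt : AnalyticAt ℝ v 0

/-- `φ` represents the germ of the flow of `v`: for every `T`, all trajectories that start close
enough to `0` solve `dy/dt = v(y)`, `y(0) = x` on `[-T, T]`. They are also required to stay in any
prescribed neighbourhood of `0`, so that only the germ of `v` at `0` matters. -/
def IsFlowGerm {n : ℕ} (v : (Fin n → ℝ) → (Fin n → ℝ))
    (φ : ℝ → (Fin n → ℝ) → (Fin n → ℝ)) : Prop :=
  ∀ T > (0 : ℝ), ∀ U ∈ 𝓝 (0 : Fin n → ℝ), ∀ᶠ x in 𝓝 (0 : Fin n → ℝ),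
    φ 0 x = x ∧ ∀ t ∈ Set.Icc (-T) T,
      φ t x ∈ U ∧ HasDerivAt (fun s => φ s x) (v (φ t x)) t

/-- `exp v = u` as germs: `u` is the time-one germ of the flow of `v`. -/
def IsExpGerm {n : ℕ} (v u : (Fin n → ℝ) → (Fin n → ℝ)) : Prop :=
  ∃ φ : ℝ → (Fin n → ℝ) → (Fin n → ℝ), IsFlowGerm v φ ∧ φ 1 =ᶠ[𝓝 0] u

/-! This is Poincaré's linearization theorem. Write `A` for the linear part of `u`. In degree `n ≥
2` the equation `f ∘ u = A ∘ f` reads `A ∘ h - h ∘ (A, …, A) = ` (terms from lower degrees) for the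
unknown coefficient `h`. The operator on the left has eigenvalues `λ_s - λ_{i_1} ⋯ λ_{i_n}`, nonzero
by non-resonance, so a formal solution tangent to the identity exists
(`homologicalOperator_surjective`, `linearizingSeries_comp`).

Convergence needs no estimate on these differences. Since all `|λ_i| < 1`, some power `A ^ N` has
norm less than one, and the formal solution `F` also satisfies `F = A ^ (-N) ∘ F ∘ q`, with `q` the
series of `u^[N]`. Because `q` contracts small balls, the right side damps the coefficients of high
degree, and `F` is bounded by its first few coefficients (`radius_pos_of_comp_eq`).

Conjugating the linear flow `e^{tL}` back by `f` then embeds `u` in a flow. The logarithmic series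
provides such an `L`: `exp (-ln (1 + sX)) (1 + sX)` has zero derivative in `s`
(`exp_logSeries_one`). -/

/-- Expanding the powers on the right gives one nonnegative term per composition, and those of every
`k < N` occur among them. Truncating both sides at the same `N` keeps all sums finite before
convergence is known. -/
theorem sum_composition_le_sum_mul_pow (N : ℕ) (p q : ℕ → ℝ) (hp : ∀ k, 0 ≤ p k)
    (hq : ∀ k, 0 ≤ q k) {a : ℝ} (ha : 0 ≤ a) :
    ∑ k ∈ Finset.Ico 1 N, a ^ k *
        ∑ c : Composition k, q c.length * ∏ j, p (c.blocksFun j) ≤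
      ∑ j ∈ Finset.Ico 1 N, q j * (∑ k ∈ Finset.Ico 1 N, a ^ k * p k) ^ j :=
  open Finset FormalMultilinearSeries in
  calc
    ∑ k ∈ Ico 1 N, a ^ k * ∑ c : Composition k, q c.length * ∏ j, p (c.blocksFun j) =
        ∑ k ∈ Ico 1 N, ∑ c : Composition k,
          q c.length * ∏ j, (a ^ c.blocksFun j * p (c.blocksFun j)) := by
      simp_rw [mul_sum]
      refine sum_congr rfl fun k _ => sum_congr rfl fun c _ => ?_
      rw [prod_mul_distrib, prod_pow_eq_pow_sum, Composition.sum_blocksFun]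
      ring
    -- The target bounds the number of blocks and each block by `N`, but not the total degree; hence
    -- only an inequality.
    _ ≤ ∑ d ∈ compPartialSumTarget 1 N N,
          q d.2.length * ∏ j : Fin d.2.length, (a ^ d.2.blocksFun j * p (d.2.blocksFun j)) := by
      rw [sum_sigma']
      refine sum_le_sum_of_subset_of_nonneg ?_ fun x _ _ => mul_nonneg (hq _)
        (prod_nonneg fun j _ => mul_nonneg (pow_nonneg ha _) (hp _))
      rintro ⟨k, c⟩ hd
      simp only [mem_Ico, mem_sigma, mem_univ, and_true] at hd
      simp only [mem_compPartialSumTarget_iff]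
      exact ⟨c.length_pos_of_pos hd.1, c.length_le.trans_lt hd.2,
        fun j => (c.blocksFun_le j).trans_lt hd.2⟩
    _ = ∑ e ∈ compPartialSumSource 1 N N, q e.1 * ∏ j : Fin e.1, (a ^ e.2 j * p (e.2 j)) := by
      symm
      apply compChangeOfVariables_sum
      rintro ⟨k, blocksFun⟩ H
      have K : (compChangeOfVariables 1 N N ⟨k, blocksFun⟩ H).snd.length = k := by simp
      congr 2 <;> try rw [K]
      rw [Fin.heq_fun_iff K.symm]
      intro j
      rw [compChangeOfVariables_blocksFun]
    _ = ∑ j ∈ Ico 1 N, q j * (∑ k ∈ Ico 1 N, a ^ k * p k) ^ j := by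
      rw [compPartialSumSource,
        ← sum_sigma' (Ico 1 N)
          (fun k : ℕ => (Fintype.piFinset fun _ : Fin k => Ico 1 N : Finset (Fin k → ℕ)))
          (fun n e => q n * ∏ j : Fin n, (a ^ e j * p (e j)))]
      congr! with j
      rw [← mul_sum]
      simp only [← @MultilinearMap.mkPiAlgebra_apply ℝ (Fin j) _ ℝ]
      simp only [←
        MultilinearMap.map_sum_finset (MultilinearMap.mkPiAlgebra ℝ (Fin j) ℝ) fun _ (m : ℕ) =>
          (a ^ m * p m)]
      simp only [MultilinearMap.mkPiAlgebra_apply]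
      simp [prod_const]

/-! ### Formal linearization and the majorant argument for its convergence. -/

section Formal

variable {E : Type*} [NormedAddCommGroup E] [NormedSpace ℝ E]

/-- The operator `h ↦ A ∘ h - h ∘ (A, …, A)` on `n`-linear maps. -/
noncomputable def homologicalOperator (A : E →L[ℝ] E) (n : ℕ)
    (h : ContinuousMultilinearMap ℝ (fun _ : Fin n => E) E) :
    ContinuousMultilinearMap ℝ (fun _ : Fin n => E) E :=
  A.compContinuousMultilinearMap h - h.compContinuousLinearMap fun _ => A

/-- The power series conjugating `p` to its linear part, built degree by degree from right inverses
`R n` of the homological operators. -/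
noncomputable def linearizingSeries (p : FormalMultilinearSeries ℝ E E)
    (R : ∀ n, ContinuousMultilinearMap ℝ (fun _ : Fin n => E) E →
      ContinuousMultilinearMap ℝ (fun _ : Fin n => E) E) : FormalMultilinearSeries ℝ E E
  | 0 => 0
  | 1 => (continuousMultilinearCurryFin1 ℝ E E).symm (ContinuousLinearMap.id ℝ E)
  | n + 2 => R (n + 2) (∑ c : { c : Composition (n + 2) // c.length < n + 2 },
      (linearizingSeries p R (c : Composition (n + 2)).length).compAlongComposition p c)

/-- In degree `n + 2` only the composition into ones involves the top coefficient, which it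
evaluates at `A v_j`. The others form exactly the right-hand side fed to `R`. -/
theorem linearizingSeries_comp (p : FormalMultilinearSeries ℝ E E) (A : E →L[ℝ] E)
    (hp : p 1 = (continuousMultilinearCurryFin1 ℝ E E).symm A)
    (R : ∀ n, ContinuousMultilinearMap ℝ (fun _ : Fin n => E) E →
      ContinuousMultilinearMap ℝ (fun _ : Fin n => E) E)
    (hR : ∀ n, 2 ≤ n → ∀ h, homologicalOperator A n (R n h) = h) :
    (linearizingSeries p R).comp p = A.compFormalMultilinearSeries (linearizingSeries p R) := by
  ext n v
  match n with
  | 0 => simp [FormalMultilinearSeries.comp_coeff_zero', linearizingSeries]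
  | 1 => simp [FormalMultilinearSeries.comp_coeff_one, linearizingSeries, hp]
  | n + 2 =>
    have hsplit : (Finset.univ : Finset (Composition (n + 2))) =
        insert (Composition.ones (n + 2))
          (Finset.univ.filter fun c : Composition (n + 2) => c.length < n + 2) := by
      ext c
      by_cases! h : c.length < n + 2
      · simp [h]
      · simp [Composition.eq_ones_iff_le_length.2 h]
    have hones : (linearizingSeries p R (Composition.ones (n + 2)).length)
        (p.applyComposition (Composition.ones (n + 2)) v) =
        linearizingSeries p R (n + 2) fun j => A (v j) := by
      rw [FormalMultilinearSeries.applyComposition_ones]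
      apply FormalMultilinearSeries.congr _ (Composition.ones_length _) fun j hj1 hj2 => ?_
      rw [hp]
      rfl
    have hrest := congrArg (fun h => h v) (hR (n + 2) (by lia)
      (∑ c : { c : Composition (n + 2) // c.length < n + 2 },
        (linearizingSeries p R (c : Composition (n + 2)).length).compAlongComposition p c))
    have hdef : R (n + 2) (∑ c : { c : Composition (n + 2) // c.length < n + 2 },
        (linearizingSeries p R (c : Composition (n + 2)).length).compAlongComposition p c) =
        linearizingSeries p R (n + 2) := by rw [linearizingSeries]
    rw [hdef] at hrest
    simp only [homologicalOperator, _root_.sub_apply,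
      _root_.sum_apply, sub_eq_iff_eq_add,
      ContinuousLinearMap.compContinuousMultilinearMap_coe, Function.comp_apply,
      ContinuousMultilinearMap.compContinuousLinearMap_apply] at hrest
    rw [FormalMultilinearSeries.comp, hsplit, Finset.sum_insert (by simp)]
    simp only [_root_.add_apply, _root_.sum_apply,
      FormalMultilinearSeries.compAlongComposition_apply, hones,
      ContinuousLinearMap.compFormalMultilinearSeries_apply']
    refine Eq.trans ?_ hrest.symm
    rw [add_comm]
    congr 1
    exact Finset.sum_subtype _ (p := fun c : Composition (n + 2) => c.length < n + 2) (by simp)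
      fun c => linearizingSeries p R c.length (p.applyComposition c v)

/-- The terms of degree at least two are `O(s ^ 2)`, so for small `s` they fit into half the gap
between `‖p 1‖` and `1`. -/
theorem exists_sum_norm_coeff_le (p : FormalMultilinearSeries ℝ E E) (hp : 0 < p.radius)
    (hp1 : ‖p 1‖ < 1) :
    ∃ s > (0 : ℝ), ∃ θ : ℝ, 0 ≤ θ ∧ θ < 1 ∧
      ∀ N, ∑ k ∈ Finset.Ico 1 N, s ^ k * ‖p k‖ ≤ θ * s := by
  obtain ⟨C, r, hC, hr, hle⟩ := p.le_mul_pow_of_radius_pos hp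
  set δ : ℝ := (1 - ‖p 1‖) / 2 with hδ
  have hδ0 : 0 < δ := by rw [hδ]; linarith
  -- The first bound makes the geometric tail at most twice its leading term; the second makes that
  -- at most `δ * s`.
  set s : ℝ := min (1 / (2 * r)) (δ / (2 * C * r ^ 2)) with hs
  have hs0 : 0 < s := by positivity
  have hrs : r * s ≤ 1 / 2 := by
    calc r * s ≤ r * (1 / (2 * r)) := by gcongr; exact min_le_left _ _
      _ = 1 / 2 := by field_simp
  have hCs : 2 * C * r ^ 2 * s ≤ δ := by
    calc 2 * C * r ^ 2 * s ≤ 2 * C * r ^ 2 * (δ / (2 * C * r ^ 2)) := by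
          gcongr; exact min_le_right _ _
      _ = δ := by field_simp
  have htail : ∀ N, ∑ k ∈ Finset.Ico 2 N, s ^ k * ‖p k‖ ≤ δ * s := fun N =>
    calc ∑ k ∈ Finset.Ico 2 N, s ^ k * ‖p k‖ ≤ ∑ k ∈ Finset.Ico 2 N, C * (r * s) ^ k := by
          refine Finset.sum_le_sum fun k _ => ?_
          calc s ^ k * ‖p k‖ ≤ s ^ k * (C * r ^ k) := by gcongr; exact hle k
            _ = C * (r * s) ^ k := by rw [mul_pow]; ring
      _ = C * ∑ k ∈ Finset.Ico 2 N, (r * s) ^ k := by rw [Finset.mul_sum]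
      _ ≤ C * ((r * s) ^ 2 / (1 - r * s)) := by
          gcongr
          exact geom_sum_Ico_le_of_lt_one (by positivity) (by linarith)
      _ ≤ C * ((r * s) ^ 2 / (1 / 2)) := by
          gcongr
          linarith
      _ = 2 * C * r ^ 2 * s * s := by ring
      _ ≤ δ * s := by gcongr
  refine ⟨s, hs0, ‖p 1‖ + δ, by positivity, by rw [hδ]; linarith, fun N => ?_⟩
  rcases le_or_gt N 1 with hN | hN
  · rw [Finset.Ico_eq_empty_of_le hN, Finset.sum_empty]
    positivity
  · rw [Finset.sum_eq_sum_Ico_succ_bot hN, pow_one, add_mul, mul_comm s]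
    exact add_le_add le_rfl (htail N)

/-- Solving for `F = B' ∘ F ∘ p` bounds the weighted coefficient sum at radius `s` by `‖B'‖` times
the one at radius `θ * s`. The gain `θ ^ j` outweighs `‖B'‖` in high degree. -/
theorem radius_pos_of_comp_eq (F p : FormalMultilinearSeries ℝ E E) (hp : 0 < p.radius)
    (hp1 : ‖p 1‖ < 1) (B B' : E →L[ℝ] E) (hB : ∀ x, B' (B x) = x)
    (hF : F.comp p = B.compFormalMultilinearSeries F) : 0 < F.radius := by
  obtain ⟨s, hs, θ, hθ0, hθ1, hsum⟩ := exists_sum_norm_coeff_le p hp hp1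
  set a : ℝ := ‖B'‖
  have hcoeff : ∀ k, ‖F k‖ ≤ a * ∑ c : Composition k, ‖F c.length‖ * ∏ j, ‖p (c.blocksFun j)‖ := by
    intro k
    have h1 : F k = B'.compContinuousMultilinearMap ((F.comp p) k) := by
      ext v
      simp [hF, hB]
    calc ‖F k‖ ≤ a * ‖(F.comp p) k‖ := by
          conv_lhs => rw [h1]
          exact ContinuousLinearMap.norm_compContinuousMultilinearMap_le _ _
      _ ≤ _ := by
          gcongr
          exact (norm_sum_le _ _).trans
            (Finset.sum_le_sum fun c _ => F.compAlongComposition_norm p c)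
  obtain ⟨K, hK⟩ : ∃ K : ℕ, a * θ ^ K ≤ 1 / 2 := by
    have h := (tendsto_pow_atTop_nhds_zero_of_lt_one hθ0 hθ1).const_mul a
    rw [mul_zero] at h
    exact ((h.eventually_lt_const (show (0 : ℝ) < 1 / 2 by norm_num)).exists).imp fun _ h => h.le
  set M : ℝ := ∑ k ∈ Finset.range K, s ^ k * ‖F k‖
  -- Degrees below `K` contribute at most `a * M`, the others at most half of the sum itself; that
  -- half can be subtracted because the sum is finite.
  have hbound : ∀ N, ∑ k ∈ Finset.Ico 1 N, s ^ k * ‖F k‖ ≤ 2 * (a * M) := by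
    intro N
    have h1 : ∑ k ∈ Finset.Ico 1 N, s ^ k * ‖F k‖ ≤
        a * ∑ j ∈ Finset.Ico 1 N, ‖F j‖ * (θ * s) ^ j :=
      calc ∑ k ∈ Finset.Ico 1 N, s ^ k * ‖F k‖
          ≤ ∑ k ∈ Finset.Ico 1 N, s ^ k *
              (a * ∑ c : Composition k, ‖F c.length‖ * ∏ j, ‖p (c.blocksFun j)‖) := by
            gcongr with k
            exact hcoeff k
        _ = a * ∑ k ∈ Finset.Ico 1 N, s ^ k *
              ∑ c : Composition k, ‖F c.length‖ * ∏ j, ‖p (c.blocksFun j)‖ := by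
            rw [Finset.mul_sum]
            exact Finset.sum_congr rfl fun k _ => by ring
        _ ≤ a * ∑ j ∈ Finset.Ico 1 N, ‖F j‖ * (∑ k ∈ Finset.Ico 1 N, s ^ k * ‖p k‖) ^ j := by
            exact mul_le_mul_of_nonneg_left (sum_composition_le_sum_mul_pow N (fun k => ‖p k‖)
              (fun k => ‖F k‖) (fun k => norm_nonneg _) (fun k => norm_nonneg _) hs.le)
              (norm_nonneg _)
        _ ≤ a * ∑ j ∈ Finset.Ico 1 N, ‖F j‖ * (θ * s) ^ j := by
            gcongr
            exact hsum N
    have h2 : a * ∑ j ∈ Finset.Ico 1 N, ‖F j‖ * (θ * s) ^ j ≤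
        a * M + 1 / 2 * ∑ k ∈ Finset.Ico 1 N, s ^ k * ‖F k‖ :=
      calc a * ∑ j ∈ Finset.Ico 1 N, ‖F j‖ * (θ * s) ^ j
          ≤ ∑ j ∈ Finset.Ico 1 N,
              (a * (if j < K then s ^ j * ‖F j‖ else 0) + 1 / 2 * (s ^ j * ‖F j‖)) := by
            rw [Finset.mul_sum]
            gcongr with j
            have hj : a * (‖F j‖ * (θ * s) ^ j) = (a * θ ^ j) * (s ^ j * ‖F j‖) := by
              rw [mul_pow]; ring
            have hsj : 0 ≤ s ^ j * ‖F j‖ := by positivity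
            rw [hj]
            split_ifs with h
            · have : a * θ ^ j ≤ a * 1 := by
                gcongr
                exact pow_le_one₀ hθ0 hθ1.le
              nlinarith
            · have : a * θ ^ j ≤ a * θ ^ K := by
                gcongr ?_ * ?_
                exact pow_le_pow_of_le_one hθ0 hθ1.le (not_lt.1 h)
              nlinarith
        _ = a * ∑ j ∈ Finset.Ico 1 N with j < K, s ^ j * ‖F j‖ +
              1 / 2 * ∑ k ∈ Finset.Ico 1 N, s ^ k * ‖F k‖ := by
            rw [Finset.sum_add_distrib, ← Finset.mul_sum, ← Finset.mul_sum, Finset.sum_filter]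
        _ ≤ _ := by
            gcongr
            refine Finset.sum_le_sum_of_subset_of_nonneg (fun j hj => ?_)
              fun _ _ _ => by positivity
            simpa using (Finset.mem_filter.1 hj).2
    linarith
  refine lt_of_lt_of_le ?_ (F.le_radius_of_eventually_le (r := ⟨s, hs.le⟩) (2 * (a * M)) ?_)
  · exact ENNReal.coe_pos.2 (show (0 : NNReal) < ⟨s, hs.le⟩ from hs)
  · filter_upwards [Ici_mem_atTop 1] with n (hn : 1 ≤ n)
    calc ‖F n‖ * s ^ n = s ^ n * ‖F n‖ := mul_comm _ _
      _ ≤ ∑ k ∈ Finset.Ico 1 (n + 1), s ^ k * ‖F k‖ :=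
          Finset.single_le_sum (f := fun k => s ^ k * ‖F k‖) (fun k _ => by positivity)
            (by simp [hn])
      _ ≤ _ := hbound _

end Formal

/-! ### Analytic linearization of a map with a contracting power. -/

section Convergence

variable {E : Type*} [NormedAddCommGroup E] [NormedSpace ℝ E]

/-- The linear part itself may have norm at least one; the majorant argument is therefore applied to
an iterate, which the same `F` linearizes. -/
theorem exists_iterate_series {u : E → E} {p F : FormalMultilinearSeries ℝ E E} {A : E →L[ℝ] E}
    (hu : HasFPowerSeriesAt u p 0) (hu0 : u 0 = 0)
    (hp : p 1 = (continuousMultilinearCurryFin1 ℝ E E).symm A)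
    (hF : F.comp p = A.compFormalMultilinearSeries F) (N : ℕ) :
    ∃ q : FormalMultilinearSeries ℝ E E, HasFPowerSeriesAt (u^[N]) q 0 ∧
      q 1 = (continuousMultilinearCurryFin1 ℝ E E).symm (A ^ N) ∧
      F.comp q = (A ^ N).compFormalMultilinearSeries F := by
  induction N with
  | zero =>
    refine ⟨FormalMultilinearSeries.id ℝ E 0, ?_, ?_, ?_⟩
    · exact (ContinuousLinearMap.id ℝ E).hasFPowerSeriesAt 0
    · ext v; simp [FormalMultilinearSeries.id]
    · rw [FormalMultilinearSeries.comp_id]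
      ext n v; simp
  | succ N ih =>
    obtain ⟨q, hq, hq1, hFq⟩ := ih
    refine ⟨q.comp p, ?_, ?_, ?_⟩
    · rw [Function.iterate_succ]
      exact HasFPowerSeriesAt.comp (by rwa [hu0]) hu
    · ext v
      simp [FormalMultilinearSeries.comp_coeff_one, hq1, hp, pow_succ]
    · rw [← FormalMultilinearSeries.comp_assoc, hFq]
      have (B : E →L[ℝ] E) : (B.compFormalMultilinearSeries F).comp p =
          B.compFormalMultilinearSeries (F.comp p) := by
        ext n v
        simp [FormalMultilinearSeries.comp]
      rw [this, hF]
      ext n v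
      simp [pow_succ]

theorem exists_analytic_linearization [CompleteSpace E] {u : E → E} (A : E ≃L[ℝ] E)
    (hu : AnalyticAt ℝ u 0) (hu0 : u 0 = 0) (hA : fderiv ℝ u 0 = A)
    (hN : ∃ N : ℕ, ‖(A : E →L[ℝ] E) ^ N‖ < 1)
    (hsurj : ∀ n, 2 ≤ n → Function.Surjective (homologicalOperator (A : E →L[ℝ] E) n)) :
    ∃ f : E → E, AnalyticAt ℝ f 0 ∧ f 0 = 0 ∧ HasFDerivAt f (ContinuousLinearMap.id ℝ E) 0 ∧
      f ∘ u =ᶠ[𝓝 0] A ∘ f := by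
  obtain ⟨p, hp⟩ := hu
  have hp1 : p 1 = (continuousMultilinearCurryFin1 ℝ E E).symm (A : E →L[ℝ] E) := by
    rw [← hA, hp.fderiv_eq]
    simp
  -- Below degree two the choice is arbitrary: `linearizingSeries` never uses it there.
  have hR : ∀ n, ∃ R : ContinuousMultilinearMap ℝ (fun _ : Fin n => E) E →
      ContinuousMultilinearMap ℝ (fun _ : Fin n => E) E,
      2 ≤ n → ∀ h, homologicalOperator (A : E →L[ℝ] E) n (R h) = h := by
    intro n
    by_cases hn : 2 ≤ n
    · exact ⟨Function.surjInv (hsurj n hn), fun _ => Function.surjInv_eq (hsurj n hn)⟩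
    · exact ⟨id, fun h => absurd h hn⟩
  choose R hR using hR
  set F := linearizingSeries p R
  have hF : F.comp p = (A : E →L[ℝ] E).compFormalMultilinearSeries F :=
    linearizingSeries_comp p A hp1 R hR
  obtain ⟨N, hN⟩ := hN
  obtain ⟨q, hq, hq1, hFq⟩ := exists_iterate_series hp hu0 hp1 hF N
  have hinv : ∀ x, ((A.symm : E →L[ℝ] E) ^ N) (((A : E →L[ℝ] E) ^ N) x) = x := by
    intro x
    have hc : (A.symm : E →L[ℝ] E) * (A : E →L[ℝ] E) = 1 := by ext; simp
    have hc' : (A : E →L[ℝ] E) * (A.symm : E →L[ℝ] E) = 1 := by ext; simp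
    have hcomm : Commute (A.symm : E →L[ℝ] E) (A : E →L[ℝ] E) := by
      rw [Commute, SemiconjBy, hc, hc']
    have := hcomm.mul_pow N
    rw [hc, one_pow] at this
    simpa using (congrArg (fun T : E →L[ℝ] E => T x) this).symm
  have hrad : 0 < F.radius :=
    radius_pos_of_comp_eq F q hq.radius_pos (by rwa [hq1, LinearIsometryEquiv.norm_map]) _ _ hinv hFq
  have hf : HasFPowerSeriesAt F.sum F 0 := (F.hasFPowerSeriesOnBall hrad).hasFPowerSeriesAt
  have hF0 : F 0 = 0 := by simp [F, linearizingSeries]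
  have hF1 : F 1 = (continuousMultilinearCurryFin1 ℝ E E).symm (ContinuousLinearMap.id ℝ E) := by
    simp [F, linearizingSeries]
  refine ⟨F.sum, hf.analyticAt, ?_, ?_, ?_⟩
  · rw [← hf.coeff_zero 0, hF0]
    rfl
  · have := hf.hasFDerivAt
    rwa [hF1, LinearIsometryEquiv.apply_symm_apply] at this
  -- Both sides have the same power series, so their difference vanishes near `0`.
  · have h1 : HasFPowerSeriesAt (F.sum ∘ u) (F.comp p) 0 :=
      HasFPowerSeriesAt.comp (by rwa [hu0]) hp
    have h2 : HasFPowerSeriesAt (A ∘ F.sum) (F.comp p) 0 := by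
      rw [hF]
      obtain ⟨r, hr⟩ := hf
      exact ⟨r, (A : E →L[ℝ] E).comp_hasFPowerSeriesOnBall hr⟩
    have h3 := h1.sub h2
    rw [sub_self] at h3
    filter_upwards [h3.eventually_eq_zero] with x hx
    exact sub_eq_zero.1 hx

theorem exists_analytic_inverse [CompleteSpace E] {f : E → E} (hf : AnalyticAt ℝ f 0)
    (hf0 : f 0 = 0) (hf1 : HasFDerivAt f (ContinuousLinearMap.id ℝ E) 0) :
    ∃ g : E → E, g 0 = 0 ∧ AnalyticAt ℝ g 0 ∧ g ∘ f =ᶠ[𝓝 0] id ∧ f ∘ g =ᶠ[𝓝 0] id := by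
  obtain ⟨p, hp⟩ := hf
  have hstrict : HasStrictFDerivAt f ((ContinuousLinearEquiv.refl ℝ E : E ≃L[ℝ] E) : E →L[ℝ] E) 0 := by
    have h := hp.hasStrictFDerivAt
    rwa [h.hasFDerivAt.unique hf1] at h
  have hp1 : p 1 = (continuousMultilinearCurryFin1 ℝ E E).symm
      ((ContinuousLinearEquiv.refl ℝ E : E ≃L[ℝ] E) : E →L[ℝ] E) := by
    rw [LinearIsometryEquiv.eq_symm_apply]
    exact hp.hasFDerivAt.unique hf1
  set e := hstrict.toOpenPartialHomeomorph f
  have he : (e : E → E) = f := rfl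
  have hsrc : (0 : E) ∈ e.source := hstrict.mem_toOpenPartialHomeomorph_source
  have hg := e.hasFPowerSeriesAt_symm hsrc (i := ContinuousLinearEquiv.refl ℝ E) (by rwa [he]) hp1
  have hg0 : e.symm 0 = 0 := by
    have := e.left_inv hsrc
    rwa [he, hf0] at this
  rw [he, hf0] at hg
  refine ⟨e.symm, hg0, hg.analyticAt, e.eventually_left_inverse hsrc, ?_⟩
  exact e.eventually_right_inverse (by simpa [he, hf0] using e.map_source hsrc)

end Convergence

/-! ### Solvability of the homological equation. -/

/-- A non-unit lies in a maximal ideal, whose residue field is finite over `ℝ` and so embeds in `ℂ`.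
The images of `d` and `c i` would be roots of `P` violating `hne`. Neither diagonalization nor
complexification is needed. -/
theorem isUnit_sub_prod_of_forall_aeval_eq_zero {B ι : Type*} [CommRing B] [Algebra ℝ B]
    [Module.Finite ℝ B] [Fintype ι] (P : Polynomial ℝ) (d : B) (c : ι → B)
    (hd : Polynomial.aeval d P = 0) (hc : ∀ i, Polynomial.aeval (c i) P = 0)
    (hne : ∀ (z : ℂ) (w : ι → ℂ), Polynomial.aeval z P = 0 →
      (∀ i, Polynomial.aeval (w i) P = 0) → z ≠ ∏ i, w i) :
    IsUnit (d - ∏ i, c i) := by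
  by_contra h
  obtain ⟨M, hM, hmem⟩ := exists_max_ideal_of_mem_nonunits h
  let _ : Field (B ⧸ M) := Ideal.Quotient.field M
  let χ : B →ₐ[ℝ] ℂ :=
    (IsAlgClosed.lift (R := ℝ) (S := B ⧸ M) (M := ℂ)).comp (Ideal.Quotient.mkₐ ℝ M)
  have hχ (b : B) (hb : Polynomial.aeval b P = 0) : Polynomial.aeval (χ b) P = 0 := by
    rw [Polynomial.aeval_algHom_apply, hb, map_zero]
  refine hne (χ d) (fun i => χ (c i)) (hχ d hd) (fun i => hχ _ (hc i)) ?_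
  rw [← map_prod, ← sub_eq_zero, ← map_sub]
  have : Ideal.Quotient.mkₐ ℝ M (d - ∏ i, c i) = 0 := Ideal.Quotient.eq_zero_iff_mem.2 hmem
  simp only [χ, AlgHom.comp_apply, this, map_zero]

section Homological

variable {E : Type*} [NormedAddCommGroup E] [NormedSpace ℝ E] {n : ℕ}

/-- Precomposition of `n`-linear maps with one linear map in each variable. -/
noncomputable def precompEnd (B : Fin n → E →L[ℝ] E) :
    Module.End ℝ (ContinuousMultilinearMap ℝ (fun _ : Fin n => E) E) where
  toFun h := h.compContinuousLinearMap B
  map_add' _ _ := rfl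
  map_smul' _ _ := rfl

/-- Postcomposition of `n`-linear maps with a linear map. -/
noncomputable def postcompEnd (A : E →L[ℝ] E) :
    Module.End ℝ (ContinuousMultilinearMap ℝ (fun _ : Fin n => E) E) where
  toFun h := A.compContinuousMultilinearMap h
  map_add' _ _ := by ext; simp
  map_smul' _ _ := by ext; simp

@[simp]
theorem precompEnd_apply (B : Fin n → E →L[ℝ] E)
    (h : ContinuousMultilinearMap ℝ (fun _ : Fin n => E) E) (v : Fin n → E) :
    precompEnd B h v = h fun i => B i (v i) := rfl

@[simp]
theorem postcompEnd_apply (A : E →L[ℝ] E)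
    (h : ContinuousMultilinearMap ℝ (fun _ : Fin n => E) E) (v : Fin n → E) :
    postcompEnd A h v = A (h v) := rfl

theorem precompEnd_mul (B B' : Fin n → E →L[ℝ] E) :
    precompEnd B * precompEnd B' = precompEnd (B' * B) := by
  ext h v
  rfl

theorem precompEnd_commute_postcompEnd (B : Fin n → E →L[ℝ] E) (A : E →L[ℝ] E) :
    Commute (precompEnd B) (postcompEnd A) := by
  ext h v
  rfl

theorem aeval_postcompEnd_apply (A : E →L[ℝ] E) (P : Polynomial ℝ)
    (h : ContinuousMultilinearMap ℝ (fun _ : Fin n => E) E) (v : Fin n → E) :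
    Polynomial.aeval (postcompEnd A) P h v =
      Polynomial.aeval (A : E →ₗ[ℝ] E) P (h v) := by
  induction P using Polynomial.induction_on' with
  | add p q hp hq => simp [hp, hq]
  | monomial k a =>
    have : (postcompEnd A ^ k) h v = ((A : E →ₗ[ℝ] E) ^ k) (h v) := by
      induction k generalizing h with
      | zero => simp
      | succ k ih => 
        rw [pow_succ', pow_succ', Module.End.mul_apply, Module.End.mul_apply, postcompEnd_apply, ih]
        rfl
    simp [Polynomial.aeval_monomial, this]

/-- Acting in a single slot is essential: there `h` is linear, so polynomial identities for `A` pass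
to the operator. -/
theorem aeval_precompEnd_apply (A : E →L[ℝ] E) (i : Fin n) (P : Polynomial ℝ)
    (h : ContinuousMultilinearMap ℝ (fun _ : Fin n => E) E) (v : Fin n → E) :
    Polynomial.aeval (precompEnd (Pi.mulSingle i A)) P h v =
      h (Function.update v i (Polynomial.aeval (A : E →ₗ[ℝ] E) P (v i))) := by
  induction P using Polynomial.induction_on' with
  | add p q hp hq => simp [hp, hq]
  | monomial k a =>
    have : (precompEnd (Pi.mulSingle i A) ^ k) h v =
        h (Function.update v i (((A : E →ₗ[ℝ] E) ^ k) (v i))) := by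
      have hk : ∀ k, (precompEnd (Pi.mulSingle i A) : Module.End ℝ
          (ContinuousMultilinearMap ℝ (fun _ : Fin n => E) E)) ^ k =
          precompEnd (Pi.mulSingle i (A ^ k)) := by
        intro k
        induction k with
        | zero => ext h v; simp
        | succ k ih => rw [pow_succ, ih, precompEnd_mul, ← Pi.mulSingle_mul, pow_succ']
      rw [hk, precompEnd_apply]
      congr 1
      ext j
      by_cases hj : j = i
      · subst hj; simp [Module.End.coe_pow]
      · simp [hj]
    simp [Polynomial.aeval_monomial, this]

-- The operator is `D - ∏ i, C i`, with `D` postcomposition by `A` and `C i` precomposition in slot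
-- `i`. These commute and, by Cayley–Hamilton, are killed by the characteristic polynomial of `A`,
-- so the unit criterion applies in the commutative finite-dimensional algebra they generate.
open scoped IsMulCommutative in
theorem homologicalOperator_surjective [FiniteDimensional ℝ E] (A : E →L[ℝ] E)
    (hne : ∀ (z : ℂ) (w : Fin n → ℂ),
      Polynomial.aeval z (LinearMap.charpoly (A : E →ₗ[ℝ] E)) = 0 →
      (∀ i, Polynomial.aeval (w i) (LinearMap.charpoly (A : E →ₗ[ℝ] E)) = 0) → z ≠ ∏ i, w i) :
    Function.Surjective (homologicalOperator A n) := by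
  have : Module.Finite ℝ (ContinuousMultilinearMap ℝ (fun _ : Fin n => E) E) :=
    Module.Finite.of_injective
      (ContinuousMultilinearMap.toMultilinearMapLinear (R' := ℝ) (A := ℝ)
        (M₁ := fun _ : Fin n => E) (M₂ := E))
      ContinuousMultilinearMap.toMultilinearMap_injective
  set D : Module.End ℝ (ContinuousMultilinearMap ℝ (fun _ : Fin n => E) E) := postcompEnd A
  set C : Fin n → Module.End ℝ (ContinuousMultilinearMap ℝ (fun _ : Fin n => E) E) :=
    fun i => precompEnd (Pi.mulSingle i A)
  have hcomm : ∀ a ∈ insert D (Set.range C), ∀ b ∈ insert D (Set.range C), a * b = b * a := by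
    rintro a (rfl | ⟨i, rfl⟩) b (rfl | ⟨j, rfl⟩)
    · rfl
    · exact (precompEnd_commute_postcompEnd _ _).symm
    · exact precompEnd_commute_postcompEnd _ _
    · simp only [C, precompEnd_mul]
      congr 1
      by_cases h : i = j
      · rw [h]
      · exact (Pi.mulSingle_commute (f := fun _ : Fin n => E →L[ℝ] E) (Ne.symm h) A A).eq
  have := Algebra.isMulCommutative_adjoin ℝ hcomm
  let d : Algebra.adjoin ℝ (insert D (Set.range C)) :=
    ⟨D, Algebra.subset_adjoin (Set.mem_insert _ _)⟩
  let c : Fin n → Algebra.adjoin ℝ (insert D (Set.range C)) :=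
    fun i => ⟨C i, Algebra.subset_adjoin (Set.mem_insert_of_mem _ ⟨i, rfl⟩)⟩
  have hunit : IsUnit (d - ∏ i, c i) := by
    refine isUnit_sub_prod_of_forall_aeval_eq_zero (LinearMap.charpoly (A : E →ₗ[ℝ] E)) d c
      ?_ (fun i => ?_) hne
    · refine Subtype.ext ?_
      refine (Polynomial.aeval_algHom_apply (Subalgebra.val _) d _).symm.trans ?_
      ext h v
      simp [d, D, aeval_postcompEnd_apply, LinearMap.aeval_self_charpoly]
    · refine Subtype.ext ?_
      refine (Polynomial.aeval_algHom_apply (Subalgebra.val _) (c i) _).symm.trans ?_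
      ext h v
      simpa [c, C, aeval_precompEnd_apply, LinearMap.aeval_self_charpoly] using
        h.map_coord_zero i (by simp)
  have hprod (s : Finset (Fin n)) :
      ((∏ i ∈ s, c i : Algebra.adjoin ℝ (insert D (Set.range C))) :
        Module.End ℝ (ContinuousMultilinearMap ℝ (fun _ : Fin n => E) E)) =
      precompEnd fun i => if i ∈ s then A else 1 := by
    induction s using Finset.induction_on with
    | empty => ext h v; simp
    | insert i s hi ih =>
      rw [Finset.prod_insert hi, MulMemClass.coe_mul, ih, precompEnd_mul]
      congr 1
      ext j x
      by_cases hj : j = i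
      · subst hj; simp [hi]
      · simp [hj]
  have hop : ((d - ∏ i, c i : Algebra.adjoin ℝ (insert D (Set.range C))) :
      Module.End ℝ (ContinuousMultilinearMap ℝ (fun _ : Fin n => E) E)) =
      D - precompEnd fun _ => A := by
    rw [AddSubgroupClass.coe_sub, hprod]
    simp [d]
  obtain ⟨r, hr⟩ := hunit.exists_right_inv
  have hr' := congrArg (fun b : Algebra.adjoin ℝ (insert D (Set.range C)) =>
    (b : Module.End ℝ (ContinuousMultilinearMap ℝ (fun _ : Fin n => E) E))) hr
  simp only [MulMemClass.coe_mul, hop] at hr'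
  intro h
  exact ⟨(r : Module.End ℝ _) h, congrArg
    (fun T : Module.End ℝ (ContinuousMultilinearMap ℝ (fun _ : Fin n => E) E) => T h) hr'⟩

end Homological

/-! ### From eigenvalue conditions to norm bounds and non-resonance. -/

section Spectrum

variable {n : ℕ}

theorem IsEigenvalueList.exists_eq_of_aeval_eq_zero {A : Matrix (Fin n) (Fin n) ℝ} {lam : Fin n → ℂ}
    (h : IsEigenvalueList A lam) {z : ℂ} (hz : Polynomial.aeval z A.charpoly = 0) :
    ∃ i, z = lam i := by
  rw [IsEigenvalueList, Matrix.charpoly_map] at h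
  rw [Polynomial.aeval_def, ← Polynomial.eval_map, h, Polynomial.eval_prod,
    Finset.prod_eq_zero_iff] at hz
  obtain ⟨i, -, hi⟩ := hz
  exact ⟨i, sub_eq_zero.1 (by simpa using hi)⟩

theorem ne_prod_of_not_isResonant {lam : Fin n → ℂ} (hres : ¬ IsResonant lam) {k : ℕ} (hk : 2 ≤ k)
    (s : Fin n) (σ : Fin k → Fin n) : lam s ≠ ∏ i, lam (σ i) := by
  intro h
  -- The exponent of `lam j` counts how often `σ` takes the value `j`.
  refine hres ⟨s, fun j => (Finset.univ.filter fun i => σ i = j).card, ?_, ?_⟩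
  · rw [← Finset.card_eq_sum_card_fiberwise (f := σ) fun _ _ => by simp]
    simpa using hk
  · rw [h, ← Finset.prod_fiberwise Finset.univ σ]
    refine Finset.prod_congr rfl fun j _ => ?_
    rw [Finset.prod_congr rfl (g := fun _ => lam j) fun i hi => by rw [(Finset.mem_filter.1 hi).2],
      Finset.prod_const]

-- Gelfand's formula over `ℂ`, brought back to `ℝ` because the row-sum norm sees only the absolute
-- values of entries.
open scoped Matrix.Norms.Operator in
theorem IsEigenvalueList.exists_norm_pow_lt_one {A : Matrix (Fin n) (Fin n) ℝ} {lam : Fin n → ℂ}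
    (h : IsEigenvalueList A lam) (hmod : ∀ i, ‖lam i‖ < 1) : ∃ N : ℕ, ‖A ^ N‖ < 1 := by
  rcases Nat.eq_zero_or_pos n with rfl | hn
  · exact ⟨0, by rw [Subsingleton.elim (A ^ 0) 0, norm_zero]; exact one_pos⟩
  have : Nonempty (Fin n) := ⟨⟨0, hn⟩⟩
  set B : Matrix (Fin n) (Fin n) ℂ := A.map (algebraMap ℝ ℂ) with hB
  have hrad : spectralRadius ℂ B < 1 := by
    refine spectrum.spectralRadius_lt_of_forall_lt (r := 1) B fun z hz => ?_
    rw [Matrix.mem_spectrum_iff_isRoot_charpoly, hB, Matrix.charpoly_map, Polynomial.IsRoot,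
      Polynomial.eval_map, ← Polynomial.aeval_def] at hz
    obtain ⟨i, rfl⟩ := h.exists_eq_of_aeval_eq_zero hz
    exact hmod i
  have hlim := spectrum.pow_nnnorm_pow_one_div_tendsto_nhds_spectralRadius B
  obtain ⟨N, hN, hN0⟩ := ((hlim.eventually_lt_const hrad).and (eventually_gt_atTop 0)).exists
  refine ⟨N, ?_⟩
  have h1 : ‖B ^ N‖₊ < 1 := by
    by_contra hcon
    have : (1 : ENNReal) ≤ ‖B ^ N‖₊ := by exact_mod_cast not_lt.1 hcon
    exact absurd hN (not_lt.2 (ENNReal.one_le_rpow this (by positivity)))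
  have h2 : ‖A ^ N‖₊ = ‖B ^ N‖₊ := by
    have : B ^ N = (A ^ N).map (algebraMap ℝ ℂ) := (Matrix.map_pow _ _ _).symm
    rw [this, Matrix.linfty_opNNNorm_def, Matrix.linfty_opNNNorm_def]
    simp
  rw [← h2] at h1
  exact_mod_cast h1

open scoped Matrix.Norms.Operator in
theorem norm_pow_le_of_toMatrix' (A : (Fin n → ℝ) →L[ℝ] (Fin n → ℝ)) (N : ℕ) :
    ‖A ^ N‖ ≤ ‖(LinearMap.toMatrix' (A : (Fin n → ℝ) →ₗ[ℝ] (Fin n → ℝ))) ^ N‖ := by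
  refine ContinuousLinearMap.opNorm_le_bound _ (norm_nonneg _) fun x => ?_
  have : (A ^ N) x =
      ((LinearMap.toMatrix' (A : (Fin n → ℝ) →ₗ[ℝ] (Fin n → ℝ))) ^ N).mulVec x := by
    rw [← Matrix.toLin'_apply, Matrix.toLin'_pow, Matrix.toLin'_toMatrix']
    simp [Module.End.coe_pow]
  rw [this]
  exact Matrix.linfty_opNorm_mulVec _ _

end Spectrum

/-! ### Existence of a linearizing germ. -/

section Linearization

variable {n : ℕ} {u : (Fin n → ℝ) → (Fin n → ℝ)}

theorem IsDiffGerm.exists_fderiv_equiv (hu : IsDiffGerm u) :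
    ∃ A : (Fin n → ℝ) ≃L[ℝ] (Fin n → ℝ), fderiv ℝ u 0 = A := by
  obtain ⟨g, hg⟩ := hu.exists_inverse
  have hud : HasFDerivAt u (fderiv ℝ u 0) 0 := hu.analyticAt.differentiableAt.hasFDerivAt
  have hgd : HasFDerivAt g (fderiv ℝ g 0) 0 := hg.analyticAt.differentiableAt.hasFDerivAt
  have h1 : (fderiv ℝ g 0).comp (fderiv ℝ u 0) = ContinuousLinearMap.id ℝ _ :=
    (HasFDerivAt.comp (0 : Fin n → ℝ) (by rwa [hu.map_zero]) hud).unique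
      ((hasFDerivAt_id 0).congr_of_eventuallyEq hg.left_inv)
  have h2 : (fderiv ℝ u 0).comp (fderiv ℝ g 0) = ContinuousLinearMap.id ℝ _ :=
    (HasFDerivAt.comp (0 : Fin n → ℝ) (by rwa [hg.map_zero]) hgd).unique
      ((hasFDerivAt_id 0).congr_of_eventuallyEq hg.right_inv)
  exact ⟨ContinuousLinearEquiv.equivOfInverse (fderiv ℝ u 0) (fderiv ℝ g 0)
    (fun x => congrArg (fun T => T x) h1) (fun x => congrArg (fun T => T x) h2), rfl⟩

theorem jacobianAtZero_mulVec (x : Fin n → ℝ) : (jacobianAtZero u).mulVec x = fderiv ℝ u 0 x := by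
  rw [jacobianAtZero, ← Matrix.toLin'_apply, Matrix.toLin'_toMatrix']
  rfl

theorem IsDiffGerm.exists_isLinearization (hu : IsDiffGerm u) {lam : Fin n → ℂ}
    (hlam : IsEigenvalueList (jacobianAtZero u) lam) (hmod : ∀ i, ‖lam i‖ < 1)
    (hres : ¬ IsResonant lam) : ∃ f g, IsLinearization u f g := by
  obtain ⟨A, hA⟩ := hu.exists_fderiv_equiv
  have hJ : jacobianAtZero u =
      LinearMap.toMatrix' ((A : (Fin n → ℝ) →L[ℝ] (Fin n → ℝ)) : (Fin n → ℝ) →ₗ[ℝ] (Fin n → ℝ)) := by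
    rw [jacobianAtZero, hA]
  have hchar : LinearMap.charpoly
      ((A : (Fin n → ℝ) →L[ℝ] (Fin n → ℝ)) : (Fin n → ℝ) →ₗ[ℝ] (Fin n → ℝ)) =
      (jacobianAtZero u).charpoly := by
    rw [hJ, ← LinearMap.charpoly_toMatrix _ (Pi.basisFun ℝ (Fin n)), LinearMap.toMatrix_eq_toMatrix']
  obtain ⟨f, hf, hf0, hf1, hconj⟩ := exists_analytic_linearization A hu.analyticAt hu.map_zero hA
    (by
      obtain ⟨N, hN⟩ := hlam.exists_norm_pow_lt_one hmod
      exact ⟨N, (norm_pow_le_of_toMatrix' _ N).trans_lt (by rwa [hJ] at hN)⟩)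
    -- Roots of the characteristic polynomial are among the `lam i`, so a forbidden equality would
    -- be a resonance of order `k`.
    (fun k hk => homologicalOperator_surjective _ fun z w hz hw => by
      rw [hchar] at hz
      simp only [hchar] at hw
      obtain ⟨s, rfl⟩ := hlam.exists_eq_of_aeval_eq_zero hz
      choose σ hσ using fun i => hlam.exists_eq_of_aeval_eq_zero (hw i)
      simp only [hσ]
      exact ne_prod_of_not_isResonant hres hk s σ)
  obtain ⟨g, hg0, hg, hgf, hfg⟩ := exists_analytic_inverse hf hf0 hf1
  have hinv : IsGermInverse f g := ⟨hg0, hg, hgf, hfg⟩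
  refine ⟨f, g, ⟨hf0, hf, g, hinv⟩, hinv, ?_⟩
  have hgt : Tendsto g (𝓝 0) (𝓝 0) := by
    simpa [ContinuousAt, hg0] using hg.continuousAt
  filter_upwards [hgt.eventually hconj, hfg] with x hx hx'
  simp only [Function.comp_apply, id_eq] at hx hx' ⊢
  rw [hx, hx', jacobianAtZero_mulVec, hA]
  rfl

end Linearization

/-! ### The conjugated linear flow and its generating field. -/

section Flow

variable {n : ℕ} {u f g : (Fin n → ℝ) → (Fin n → ℝ)} {L : Matrix (Fin n) (Fin n) ℝ}

open scoped Matrix.Norms.Operator in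
theorem analyticAt_exp_smul_apply (L : Matrix (Fin n) (Fin n) ℝ) (i j : Fin n) (t : ℝ) :
    AnalyticAt ℝ (fun s : ℝ => NormedSpace.exp (s • L) i j) t := by
  have h1 : AnalyticAt ℝ (fun s : ℝ => NormedSpace.exp (s • L)) t :=
    (NormedSpace.exp_analytic (𝕂 := ℝ) (t • L)).comp_of_eq
      ((LinearMap.toSpanSingleton ℝ _ L).toContinuousLinearMap.analyticAt t) rfl
  exact (LinearMap.toContinuousLinearMap
    (Matrix.entryLinearMap ℝ ℝ i j : Matrix (Fin n) (Fin n) ℝ →ₗ[ℝ] ℝ)).analyticAt _ |>.comp h1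

open scoped Matrix.Norms.Operator in
theorem hasDerivAt_exp_smul_mulVec (L : Matrix (Fin n) (Fin n) ℝ) (y : Fin n → ℝ) (t : ℝ) :
    HasDerivAt (fun s : ℝ => (NormedSpace.exp (s • L)).mulVec y)
      (L.mulVec ((NormedSpace.exp (t • L)).mulVec y)) t := by
  have h1 := hasDerivAt_exp_smul_const' L t
  have h2 := (LinearMap.toContinuousLinearMap
    ((Matrix.mulVecBilin ℝ ℝ).flip y : Matrix (Fin n) (Fin n) ℝ →ₗ[ℝ] (Fin n → ℝ))).hasFDerivAt
      (x := NormedSpace.exp (t • L))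
  rw [Matrix.mulVec_mulVec]
  exact h2.comp_hasDerivAt t h1

theorem exp_add_smul_mulVec (L : Matrix (Fin n) (Fin n) ℝ) (t s : ℝ) (y : Fin n → ℝ) :
    (NormedSpace.exp ((t + s) • L)).mulVec y =
      (NormedSpace.exp (t • L)).mulVec ((NormedSpace.exp (s • L)).mulVec y) := by
  rw [Matrix.mulVec_mulVec, add_smul, Matrix.exp_add_of_commute]
  exact ((Commute.refl L).smul_left t).smul_right s

theorem analyticAt_exp_smul_mulVec (hf : AnalyticAt ℝ f 0) (t : ℝ) :
    AnalyticAt ℝ (fun p : ℝ × (Fin n → ℝ) => (NormedSpace.exp (p.1 • L)).mulVec (f p.2)) (t, 0) := by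
  rw [analyticAt_pi_iff]
  intro i
  simp only [Matrix.mulVec, dotProduct]
  refine Finset.analyticAt_fun_sum _ fun j _ => AnalyticAt.fun_mul ?_ ?_
  · exact (analyticAt_exp_smul_apply L i j t).comp_of_eq analyticAt_fst rfl
  · exact (analyticAt_pi_iff.1 hf j).comp_of_eq analyticAt_snd rfl

theorem IsGermInverse.analyticAt_conjFlow (h : IsGermInverse f g) (hf : AnalyticAt ℝ f 0)
    (hf0 : f 0 = 0) (L : Matrix (Fin n) (Fin n) ℝ) (t : ℝ) :
    AnalyticAt ℝ (fun p : ℝ × (Fin n → ℝ) => conjFlow f g L p.1 p.2) (t, 0) :=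
  h.analyticAt.comp_of_eq (analyticAt_exp_smul_mulVec hf t) (by simp [hf0])

theorem tendsto_exp_smul_mulVec (hf : AnalyticAt ℝ f 0) (hf0 : f 0 = 0) (t : ℝ) :
    Tendsto (fun x => (NormedSpace.exp (t • L)).mulVec (f x)) (𝓝 0) (𝓝 0) := by
  have h : ContinuousAt (fun x => (NormedSpace.exp (t • L)).mulVec (f x)) 0 :=
    (analyticAt_exp_smul_mulVec (L := L) hf t).continuousAt.comp_of_eq
      (f := fun x : Fin n → ℝ => (t, x)) (by fun_prop) rfl
  simpa [ContinuousAt, hf0] using h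

theorem IsGermInverse.conjFlow_comp (h : IsGermInverse f g) (hf : AnalyticAt ℝ f 0)
    (hf0 : f 0 = 0) (L : Matrix (Fin n) (Fin n) ℝ) (t s : ℝ) :
    conjFlow f g L t ∘ conjFlow f g L s =ᶠ[𝓝 0] conjFlow f g L (t + s) := by
  filter_upwards [(tendsto_exp_smul_mulVec (L := L) hf hf0 s).eventually h.right_inv] with x hx
  simp only [Function.comp_apply, id_eq] at hx
  simp only [Function.comp_apply, conjFlow, hx, exp_add_smul_mulVec]

theorem IsGermInverse.conjFlow_zero (h : IsGermInverse f g) (L : Matrix (Fin n) (Fin n) ℝ) :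
    conjFlow f g L 0 =ᶠ[𝓝 0] id := by
  filter_upwards [h.left_inv] with x hx
  simpa [conjFlow] using hx

theorem IsLinearization.isEmbeddingFlow (hu : IsDiffGerm u) (h : IsLinearization u f g)
    (hL : NormedSpace.exp L = jacobianAtZero u) : IsEmbeddingFlow u (conjFlow f g L) := by
  have hf := h.isDiffGerm.analyticAt
  have hf0 := h.isDiffGerm.map_zero
  have hinv := h.isGermInverse
  have hzero (t : ℝ) : conjFlow f g L t 0 = 0 := by simp [conjFlow, hf0, hinv.map_zero]
  have han (t : ℝ) : AnalyticAt ℝ (conjFlow f g L t) 0 :=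
    (hinv.analyticAt_conjFlow hf hf0 L t).comp_of_eq
      (f := fun x : Fin n → ℝ => (t, x)) (analyticAt_const.prod analyticAt_id) rfl
  have hcomp := hinv.conjFlow_comp hf hf0 L
  refine ⟨fun t => ⟨hzero t, han t, conjFlow f g L (-t), hzero _, han _, ?_, ?_⟩,
    hinv.analyticAt_conjFlow hf hf0 L, hcomp, hzero, hinv.conjFlow_zero L, ?_⟩
  · exact (hcomp (-t) t).trans (by rw [neg_add_cancel]; exact hinv.conjFlow_zero L)
  · exact (hcomp t (-t)).trans (by rw [add_neg_cancel]; exact hinv.conjFlow_zero L)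
  · have hft : Tendsto f (𝓝 0) (𝓝 0) := by simpa [ContinuousAt, hf0] using hf.continuousAt
    have hut : Tendsto u (𝓝 0) (𝓝 0) := by
      simpa [ContinuousAt, hu.map_zero] using hu.analyticAt.continuousAt
    -- The conjugacy is read at `f x`, giving `f (u x) = J(0) (f x)`; applying `g` then recovers `u
    -- x`.
    filter_upwards [hft.eventually h.conj, hinv.left_inv, hut.eventually hinv.left_inv]
      with x h1 h2 h3
    simp only [Function.comp_apply, id_eq] at h1 h2 h3
    rw [h2] at h1
    rw [conjFlow, one_smul, hL, ← h1, h3]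

/-- The vector field generating the flow `f⁻¹ (e^{t L} f)`. -/
noncomputable def conjField (f g : (Fin n → ℝ) → (Fin n → ℝ)) (L : Matrix (Fin n) (Fin n) ℝ)
    (x : Fin n → ℝ) : Fin n → ℝ :=
  fderiv ℝ g (f x) (L.mulVec (f x))

theorem IsGermInverse.isVectorFieldGerm (h : IsGermInverse f g) (hf : AnalyticAt ℝ f 0)
    (hf0 : f 0 = 0) (L : Matrix (Fin n) (Fin n) ℝ) : IsVectorFieldGerm (conjField f g L) := by
  refine ⟨by simp [conjField, hf0], ?_⟩
  have h1 : AnalyticAt ℝ (fun x => fderiv ℝ g (f x)) 0 :=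
    h.analyticAt.fderiv.comp_of_eq hf hf0
  have h2 : AnalyticAt ℝ (fun x => L.mulVec (f x)) 0 :=
    ((LinearMap.toContinuousLinearMap (Matrix.toLin' L)).analyticAt _).comp hf
  exact ((ContinuousLinearMap.apply ℝ (Fin n → ℝ)).flip.analyticAt_bilinear _).comp (h1.prod h2)

/-- Chain rule for `g` along `y = e^{tL} f(x)`, with `f (g y) = y` identifying the derivative as the
field at `g y`. -/
theorem IsGermInverse.isFlowGerm (h : IsGermInverse f g) (hf : AnalyticAt ℝ f 0)
    (hf0 : f 0 = 0) (L : Matrix (Fin n) (Fin n) ℝ) :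
    IsFlowGerm (conjField f g L) (conjFlow f g L) := by
  intro T _ U hU
  have hgt : Tendsto g (𝓝 0) (𝓝 0) := by
    simpa [ContinuousAt, h.map_zero] using h.analyticAt.continuousAt
  have hW : ∀ᶠ y in 𝓝 (0 : Fin n → ℝ), AnalyticAt ℝ g y ∧ f (g y) = y ∧ g y ∈ U :=
    h.analyticAt.eventually_analyticAt.and (h.right_inv.and (hgt.eventually hU))
  -- Compactness of `[-T, T]` yields one neighbourhood of starting points for all times.
  have htube : ∀ᶠ x in 𝓝 (0 : Fin n → ℝ), ∀ t ∈ Set.Icc (-T) T,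
      AnalyticAt ℝ g ((NormedSpace.exp (t • L)).mulVec (f x)) ∧
      f (g ((NormedSpace.exp (t • L)).mulVec (f x))) = (NormedSpace.exp (t • L)).mulVec (f x) ∧
      g ((NormedSpace.exp (t • L)).mulVec (f x)) ∈ U := by
    refine isCompact_Icc.eventually_forall_of_forall_eventually fun t _ => ?_
    have hc : ContinuousAt
        (fun z : (Fin n → ℝ) × ℝ => (NormedSpace.exp (z.2 • L)).mulVec (f z.1)) (0, t) :=
      (analyticAt_exp_smul_mulVec (L := L) hf t).continuousAt.comp_of_eq
        (f := fun z : (Fin n → ℝ) × ℝ => (z.2, z.1)) (by fun_prop) rfl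
    have hc' : Tendsto (fun z : (Fin n → ℝ) × ℝ => (NormedSpace.exp (z.2 • L)).mulVec (f z.1))
        (𝓝 (0, t)) (𝓝 0) := by simpa [ContinuousAt, hf0] using hc
    exact hc'.eventually hW
  filter_upwards [htube, h.conjFlow_zero L] with x hx hx0
  refine ⟨hx0, fun t ht => ?_⟩
  obtain ⟨hg, hfg, hmem⟩ := hx t ht
  refine ⟨hmem, ?_⟩
  have := hg.differentiableAt.hasFDerivAt.comp_hasDerivAt t (hasDerivAt_exp_smul_mulVec L (f x) t)
  simp only [conjField, conjFlow, hfg]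
  exact this

end Flow

/-! ### The logarithmic series in a Banach algebra and for matrices. -/

/-- Take the minimum of `N` on the compact unit sphere. This transfers the decay of powers from an
arbitrary submultiplicative norm to the ambient one. -/
theorem Seminorm.exists_norm_le_mul {V : Type*} [NormedAddCommGroup V] [NormedSpace ℝ V]
    [FiniteDimensional ℝ V] (N : Seminorm ℝ V) (hN : ∀ x, N x = 0 → x = 0) :
    ∃ C : ℝ, 0 ≤ C ∧ ∀ x, ‖x‖ ≤ C * N x := by
  have hcont : Continuous N := continuousOn_univ.1 (N.convexOn.continuousOn isOpen_univ)
  rcases (Metric.sphere (0 : V) 1).eq_empty_or_nonempty with hS | hS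
  · have : Subsingleton V := by
      by_contra h
      rw [not_subsingleton_iff_nontrivial] at h
      exact (NormedSpace.sphere_nonempty.2 zero_le_one).ne_empty hS
    exact ⟨0, le_rfl, fun x => by simp [Subsingleton.elim x 0]⟩
  · obtain ⟨y, hy, hmin⟩ := (isCompact_sphere (0 : V) 1).exists_isMinOn hS hcont.continuousOn
    have hy0 : 0 < N y := (apply_nonneg N y).lt_of_ne' fun h => by
      rw [hN y h] at hy
      simp at hy
    refine ⟨(N y)⁻¹, by positivity, fun x => ?_⟩
    rcases eq_or_ne x 0 with rfl | hx
    · simp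
    · have hx0 : 0 < ‖x‖ := norm_pos_iff.2 hx
      have h1 : N y ≤ N (‖x‖⁻¹ • x) := hmin (by simp [norm_smul, hx0.ne'])
      rw [map_smul_eq_mul, norm_inv, norm_norm, inv_mul_eq_div, le_div_iff₀ hx0] at h1
      rw [inv_mul_eq_div, le_div_iff₀ hy0]
      linarith

section Log

variable {𝔸 : Type*} [NormedRing 𝔸] [NormedAlgebra ℝ 𝔸]

/-- Commutation lets `exp (F s)` be factored out, so only the derivative of `exp` at `0` is needed.
-/
theorem HasDerivAt.exp_of_commute [CompleteSpace 𝔸] {F : ℝ → 𝔸} {F' : 𝔸} {s : ℝ} (hF : HasDerivAt F F' s)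
    (hcomm : ∀ t, Commute (F s) (F t)) :
    HasDerivAt (fun t => NormedSpace.exp (F t)) (NormedSpace.exp (F s) * F') s := by
  let _ := NormedAlgebra.restrictScalars ℚ ℝ 𝔸
  have h1 : (fun t => NormedSpace.exp (F t)) =
      fun t => NormedSpace.exp (F s) * NormedSpace.exp (F t - F s) := by
    ext t
    rw [← NormedSpace.exp_add_of_commute ((hcomm t).sub_right (Commute.refl _)), add_sub_cancel]
  rw [h1]
  refine HasDerivAt.const_mul _ ?_
  have h2 : HasFDerivAt (NormedSpace.exp : 𝔸 → 𝔸) (1 : 𝔸 →L[ℝ] 𝔸) (F s - F s) := by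
    rw [sub_self]
    exact hasFDerivAt_exp_zero
  exact h2.comp_hasDerivAt s (hF.sub_const (F s))

/-- The logarithmic series of `1 + s X`. -/
noncomputable def logSeries (X : 𝔸) (s : ℝ) : 𝔸 :=
  ∑' k : ℕ, ((-1 : ℝ) ^ k / ((k : ℝ) + 1) * s ^ (k + 1)) • X ^ (k + 1)

/-- Geometric decay of powers replaces `‖X‖ < 1`, which may fail in the ambient norm. -/
theorem norm_smul_pow_le {X : 𝔸} {C r ρ s : ℝ}
    (hX : ∀ k : ℕ, ‖X ^ (k + 1)‖ ≤ C * r ^ (k + 1)) (hs : |s| ≤ ρ) (k : ℕ) :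
    ‖((-s) ^ k) • X ^ (k + 1)‖ ≤ C * r * (ρ * r) ^ k := by
  rw [norm_smul, norm_pow, norm_neg, Real.norm_eq_abs]
  have hρ : 0 ≤ ρ := (abs_nonneg s).trans hs
  calc |s| ^ k * ‖X ^ (k + 1)‖ ≤ ρ ^ k * (C * r ^ (k + 1)) := by gcongr; exact hX k
    _ = C * r * (ρ * r) ^ k := by rw [mul_pow]; ring

theorem summable_logSeries [CompleteSpace 𝔸] {X : 𝔸} {C r : ℝ} (hr : 0 ≤ r) (hr1 : r < 1)
    (hX : ∀ k : ℕ, ‖X ^ (k + 1)‖ ≤ C * r ^ (k + 1)) :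
    Summable fun k : ℕ => ((-1 : ℝ) ^ k / ((k : ℝ) + 1)) • X ^ (k + 1) := by
  refine Summable.of_norm_bounded
    ((summable_geometric_of_lt_one hr hr1).mul_left (C * r)) fun k => ?_
  have h1 : ‖(-1 : ℝ) ^ k / ((k : ℝ) + 1)‖ ≤ 1 := by
    rw [norm_div, norm_pow, norm_neg, norm_one, one_pow, Real.norm_of_nonneg (by positivity)]
    exact div_le_one_of_le₀ (by linarith [Nat.cast_nonneg (α := ℝ) k]) (by positivity)
  calc ‖((-1 : ℝ) ^ k / ((k : ℝ) + 1)) • X ^ (k + 1)‖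
      ≤ 1 * (C * r ^ (k + 1)) := by
        rw [norm_smul]
        exact mul_le_mul h1 (hX k) (norm_nonneg _) zero_le_one
    _ = C * r * r ^ k := by ring

theorem hasDerivAt_logSeries [CompleteSpace 𝔸] {X : 𝔸} {C r ρ s : ℝ} (hr : 0 ≤ r) (hρ : 0 < ρ)
    (hρr : ρ * r < 1) (hX : ∀ k : ℕ, ‖X ^ (k + 1)‖ ≤ C * r ^ (k + 1)) (hs : |s| < ρ) :
    HasDerivAt (logSeries X) (∑' k : ℕ, ((-s) ^ k) • X ^ (k + 1)) s := by
  refine hasDerivAt_tsum_of_isPreconnected (u := fun k => C * r * (ρ * r) ^ k)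
    (g := fun (k : ℕ) t => ((-1 : ℝ) ^ k / ((k : ℝ) + 1) * t ^ (k + 1)) • X ^ (k + 1))
    (g' := fun (k : ℕ) t => ((-t) ^ k) • X ^ (k + 1))
    (t := Metric.ball 0 ρ) (y₀ := 0)
    ((summable_geometric_of_lt_one (by positivity) hρr).mul_left _) Metric.isOpen_ball
    (convex_ball 0 ρ).isPreconnected (fun k t _ => ?_) (fun k t ht => ?_)
    (Metric.mem_ball_self hρ) (by simp) (by simpa using hs)
  · have h := ((hasDerivAt_pow (k + 1) t).const_mul ((-1 : ℝ) ^ k / ((k : ℝ) + 1))).smul_const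
      (X ^ (k + 1))
    convert h using 2
    push_cast
    rw [neg_pow]
    field_simp
  · exact norm_smul_pow_le hX (by simpa using (Metric.mem_ball.1 ht).le) k

/-- The series telescopes: it is `X (1 + sX)⁻¹`, the derivative of the logarithm. -/
theorem tsum_neg_pow_smul_mul [CompleteSpace 𝔸] {X : 𝔸} {C r ρ s : ℝ} (hr : 0 ≤ r)
    (hρr : ρ * r < 1) (hX : ∀ k : ℕ, ‖X ^ (k + 1)‖ ≤ C * r ^ (k + 1)) (hs : |s| ≤ ρ) :
    (∑' k : ℕ, ((-s) ^ k) • X ^ (k + 1)) * (1 + s • X) = X := by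
  have hρ : 0 ≤ ρ := (abs_nonneg s).trans hs
  have hsum : Summable fun k : ℕ => ((-s) ^ k) • X ^ (k + 1) :=
    Summable.of_norm_bounded ((summable_geometric_of_lt_one (by positivity) hρr).mul_left _)
      (norm_smul_pow_le hX hs)
  have h1 : (∑' k : ℕ, ((-s) ^ k) • X ^ (k + 1)) * (s • X) =
      -∑' k : ℕ, ((-s) ^ (k + 1)) • X ^ (k + 1 + 1) := by
    rw [← hsum.tsum_mul_right, ← tsum_neg]
    refine tsum_congr fun k => ?_
    rw [smul_mul_smul_comm, ← pow_succ, ← neg_smul]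
    congr 1
    ring
  rw [mul_add, mul_one, h1, hsum.tsum_eq_zero_add]
  simp

theorem commute_logSeries {X : 𝔸} (s t : ℝ) : Commute (logSeries X s) (logSeries X t) := by
  refine Commute.tsum_right _ fun k => Commute.tsum_left _ fun j => ?_
  exact (((Commute.refl X).pow_pow _ _).smul_left _).smul_right _

theorem exp_logSeries_one [CompleteSpace 𝔸] {X : 𝔸} {C r : ℝ} (hr : 0 ≤ r) (hr1 : r < 1)
    (hX : ∀ k : ℕ, ‖X ^ (k + 1)‖ ≤ C * r ^ (k + 1)) :
    NormedSpace.exp (logSeries X 1) = 1 + X := by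
  let _ := NormedAlgebra.restrictScalars ℚ ℝ 𝔸
  -- With `ρ > 1` the endpoint `s = 1` is interior to the interval of termwise differentiation.
  obtain ⟨ρ, hρ1, hρr⟩ : ∃ ρ : ℝ, 1 < ρ ∧ ρ * r < 1 := by
    refine ⟨2 / (1 + r), by rw [lt_div_iff₀] <;> linarith, ?_⟩
    rw [div_mul_eq_mul_div, div_lt_one] <;> linarith
  have hderiv : ∀ s ∈ Set.Icc (0 : ℝ) 1, HasDerivAt
      (fun s => NormedSpace.exp (-logSeries X s) * (1 + s • X)) 0 s := by
    intro s hs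
    have hs' : |s| < ρ := (abs_le.2 ⟨by linarith [hs.1], hs.2⟩).trans_lt hρ1
    have h1 := (hasDerivAt_logSeries hr (by linarith) hρr hX hs').neg.exp_of_commute
      fun t => ((commute_logSeries s t).neg_left).neg_right
    have h2 : HasDerivAt (fun s : ℝ => (1 : 𝔸) + s • X) X s := by
      simpa using ((hasDerivAt_id s).smul_const X).const_add (1 : 𝔸)
    have h3 := h1.mul h2
    rw [mul_neg, neg_mul, mul_assoc, tsum_neg_pow_smul_mul hr hρr hX hs'.le] at h3
    rw [Pi.neg_apply, neg_add_cancel] at h3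
    exact h3
  have hconst := constant_of_has_deriv_right_zero
    (fun s hs => (hderiv s hs).continuousAt.continuousWithinAt)
    (fun s hs => (hderiv s (Set.Ico_subset_Icc_self hs)).hasDerivWithinAt) 1
    (Set.right_mem_Icc.2 zero_le_one)
  have h0 : logSeries X 0 = 0 := by simp [logSeries]
  simp only [h0, neg_zero, NormedSpace.exp_zero, one_smul, zero_smul, add_zero, mul_one] at hconst
  calc NormedSpace.exp (logSeries X 1)
      = NormedSpace.exp (logSeries X 1) *
          (NormedSpace.exp (-logSeries X 1) * (1 + X)) := by rw [hconst, mul_one]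
    _ = 1 + X := by
        rw [← mul_assoc, ← NormedSpace.exp_add_of_commute (Commute.refl _).neg_right,
          add_neg_cancel, NormedSpace.exp_zero, one_mul]

end Log

section MatrixLog

variable {n : ℕ}

open scoped Matrix.Norms.Operator in
theorem matrixLog_spec (A : Matrix (Fin n) (Fin n) ℝ)
    (N : AlgebraNorm ℝ (Matrix (Fin n) (Fin n) ℝ)) (hN : N (A - 1) < 1) :
    Summable (matrixLogTerm A) ∧ NormedSpace.exp (matrixLog A) = A := by
  obtain ⟨C, hC, hle⟩ := N.toSeminorm.exists_norm_le_mul fun x hx => N.eq_zero_of_map_eq_zero' x hx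
  -- Only positive powers are bounded this way, as `N 1` may exceed `1`.
  have hpow (k : ℕ) : N ((A - 1) ^ (k + 1)) ≤ N (A - 1) ^ (k + 1) :=
    map_pow_le_pow N _ k.succ_ne_zero
  have hX (k : ℕ) : ‖(A - 1) ^ (k + 1)‖ ≤ C * N (A - 1) ^ (k + 1) :=
    (hle _).trans (mul_le_mul_of_nonneg_left (hpow k) hC)
  refine ⟨summable_logSeries (apply_nonneg N _) hN hX, ?_⟩
  have hlog : matrixLog A = logSeries (A - 1) 1 := by
    simp only [logSeries, matrixLog, matrixLogTerm, one_pow, mul_one]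
    rfl
  rw [hlog]
  exact (exp_logSeries_one (apply_nonneg N _) hN hX).trans (add_sub_cancel 1 A)

end MatrixLog

/-! ### Linearization, embedding and logarithm combined. -/

theorem mainTheorem3 (n : ℕ) (u : (Fin n → ℝ) → (Fin n → ℝ)) (hu : IsDiffGerm u)
    (lam : Fin n → ℂ) (hlam : IsEigenvalueList (jacobianAtZero u) lam)
    (hmod : ∀ i, ‖lam i‖ < 1) (hres : ¬ IsResonant lam) :
    -- a linearizing germ exists
    (∃ f g, IsLinearization u f g) ∧
    -- every linearizing germ and every real logarithm of `J(0)` solve the embedding problem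
    (∀ L : Matrix (Fin n) (Fin n) ℝ, NormedSpace.exp L = jacobianAtZero u →
      ∀ f g, IsLinearization u f g →
        IsEmbeddingFlow u (conjFlow f g L) ∧
        ∃ v, IsVectorFieldGerm v ∧ IsFlowGerm v (conjFlow f g L) ∧ IsExpGerm v u) ∧
    -- if `|J(0) - E| < 1` for a submultiplicative norm, then `ln J(0)` is such a logarithm
    (∀ N : AlgebraNorm ℝ (Matrix (Fin n) (Fin n) ℝ), N (jacobianAtZero u - 1) < 1 →
      Summable (matrixLogTerm (jacobianAtZero u)) ∧
      NormedSpace.exp (matrixLog (jacobianAtZero u)) = jacobianAtZero u ∧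
      (∀ f g, IsLinearization u f g →
        IsEmbeddingFlow u (conjFlow f g (matrixLog (jacobianAtZero u)))) ∧
      ∃ v, IsVectorFieldGerm v ∧ IsExpGerm v u) := by
  have hlin := hu.exists_isLinearization hlam hmod hres
  have hembed : ∀ L : Matrix (Fin n) (Fin n) ℝ, NormedSpace.exp L = jacobianAtZero u →
      ∀ f g, IsLinearization u f g →
        IsEmbeddingFlow u (conjFlow f g L) ∧
        ∃ v, IsVectorFieldGerm v ∧ IsFlowGerm v (conjFlow f g L) ∧ IsExpGerm v u := by
    intro L hL f g h
    have hf := h.isDiffGerm.analyticAt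
    have hf0 := h.isDiffGerm.map_zero
    have hemb := h.isEmbeddingFlow hu hL
    have hflow := h.isGermInverse.isFlowGerm hf hf0 L
    exact ⟨hemb, conjField f g L, h.isGermInverse.isVectorFieldGerm hf hf0 L, hflow,
      conjFlow f g L, hflow, hemb.time_one⟩
  refine ⟨hlin, hembed, fun N hN => ?_⟩
  obtain ⟨hsum, hexp⟩ := matrixLog_spec (jacobianAtZero u) N hN
  refine ⟨hsum, hexp, fun f g h => (hembed _ hexp f g h).1, ?_⟩
  obtain ⟨f, g, h⟩ := hlin
  obtain ⟨-, v, hv, -, hvu⟩ := hembed _ hexp f g h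
  exact ⟨v, hv, hvu⟩
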